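/- Let $1<\gamma<3$, $A>0$, $\rho_0>0$ be constants, and put $P(\rho)=A\rho^\gamma$, $c(\rho)=\sqrt{P'(\rho)}$, $h(\rho)=\frac{c^2(\rho)}{\gamma-1}$ for $\rho>0$. For $n\in\{2,3\}$ and $b_0>0$, a self-similar background solution consists of a number $s_0>b_0$ and differentiable functions $\rho>0$ and $u$ on $[b_0,s_0]$ (derivatives at the end points being one-sided) such that $(s-u)^2-c^2(\rho)$ does not vanish on $[b_0,s_0]$ and (2.1) $\displaystyle \rho'(s)=\frac{(n-1)(s-u)\rho u}{s\left((s-u)^2-c^2(\rho)\right)},\qquad u'(s)=\frac{(n-1)c^2(\rho)u}{s\left((s-u)^2-c^2(\rho)\right)}\qquad (b_0\le s\le s_0),$ (2.2) $s_0\left(\rho(s_0)-\rho_0\right)-\rho(s_0)u(s_0)=0,\qquad s_0u(s_0)-\left(\tfrac12u(s_0)^2+h(\rho(s_0))-h(\rho_0)\right)=0,$ (2.3) $u(s_0)-c(\rho(s_0))<s_0<u(s_0)+c(\rho(s_0)),\qquad c(\rho_0)<s_0,$ (2.4) $u(b_0)=b_0.$ **Lemma 2.1.** There are positive constants $B$ and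 $C$, depending only on $\gamma$, $A$ and $\rho_0$, such that for $n\in\{2,3\}$ and every $b_0\ge B$, every self-similar background solution $(s_0,\rho,u)$ satisfies the following for all $s\in[b_0,s_0]$. Here $\theta$ stands for a quantity, different in each item and possibly depending on everything, with $|\theta|\le C\left(b_0^{-2/(\gamma-1)}+b_0^{-2}\right)$. (i) $s_0=b_0(1+\theta)$. (ii) $u(s)=b_0(1+\theta)$. (iii) $\rho(s)=\left(\frac{\gamma-1}{2A\gamma}\right)^{\frac1{\gamma-1}}b_0^{\frac2{\gamma-1}}(1+\theta)$. (iv) $u^2(s)-c^2(\rho(s))=\frac{3-\gamma}2b_0^2(1+\theta)>0$. (v) $(s-u(s))^2-c^2(\rho(s))=-\frac{\gamma-1}2b_0^2(1+\theta)<0$. (vi) $u(s)+c(\rho(s))-s=\sqrt{\frac{\gamma-1}2}\,b_0(1+\theta)>0$. (vii) $u(s)-c(\rho(s))-s=-\sqrt{\frac{\gamma-1}2}\,b_0(1+\theta)<0$. (viii) $|\rho'(s)|\le C\,b_0^{-1}$. (ix) $u'(s)=-(n-1)(1+\theta)<0$. -/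

import Mathlib

open Set

noncomputable section

namespace PistonFlow

/-- Pressure law `P(ρ) = A ρ ^ γ` of a polytropic gas. -/
def pressure (A γ ρ : ℝ) : ℝ := A * ρ ^ γ

/-- Local sound speed `c(ρ) = √(P'(ρ))`. -/
def soundSpeed (A γ ρ : ℝ) : ℝ := √(deriv (pressure A γ) ρ)

/-- Specific enthalpy `h(ρ) = c(ρ)² / (γ - 1)`. -/
def enthalpy (A γ ρ : ℝ) : ℝ := soundSpeed A γ ρ ^ 2 / (γ - 1)

/-- For positive density the sound speed is `√(A γ ρ ^ (γ - 1))`. -/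
theorem soundSpeed_of_pos {A γ ρ : ℝ} (hρ : 0 < ρ) :
    soundSpeed A γ ρ = √(A * γ * ρ ^ (γ - 1)) := by
  have h : HasDerivAt (pressure A γ) (A * (γ * ρ ^ (γ - 1))) ρ :=
    (Real.hasDerivAt_rpow_const (Or.inl hρ.ne')).const_mul A
  rw [soundSpeed, h.deriv, mul_assoc]

/-- The common denominator factor `(s - u)² - c²(ρ)` of the self-similar system. -/
def denom (A γ s ρ u : ℝ) : ℝ := (s - u) ^ 2 - soundSpeed A γ ρ ^ 2

/-- `(s₀, ρ, u)` is a self-similar background solution for the piston `r = b₀ t` expanding in the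
static gas of density `ρ₀` in `n` space dimensions: `r = s₀ t` is the shock, and `ρ(r / t)` and
`u(r / t)` are the density and the radial velocity between the piston and the shock.
Derivatives at the two end points of `[b₀, s₀]` are one-sided. -/
structure IsBackgroundSolution (n : ℕ) (A γ ρ₀ b₀ s₀ : ℝ) (ρ u : ℝ → ℝ) : Prop where
  /-- The shock lies ahead of the piston. -/
  shock_ahead : b₀ < s₀
  /-- The density is positive. -/
  density_pos : ∀ s ∈ Icc b₀ s₀, 0 < ρ s
  /-- The system is meaningful: its denominator does not vanish. -/
  denom_ne_zero : ∀ s ∈ Icc b₀ s₀, denom A γ s (ρ s) (u s) ≠ 0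
  /-- The equation for `ρ'`. -/
  density_ode : ∀ s ∈ Icc b₀ s₀,
    HasDerivWithinAt ρ
      (((n : ℝ) - 1) * (s - u s) * ρ s * u s / (s * denom A γ s (ρ s) (u s))) (Icc b₀ s₀) s
  /-- The equation for `u'`. -/
  velocity_ode : ∀ s ∈ Icc b₀ s₀,
    HasDerivWithinAt u
      (((n : ℝ) - 1) * soundSpeed A γ (ρ s) ^ 2 * u s / (s * denom A γ s (ρ s) (u s)))
      (Icc b₀ s₀) s
  /-- Rankine-Hugoniot condition for the mass, `s₀ [ρ] - [ρ u] = 0`; the gas ahead is at rest. -/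
  rh_mass : s₀ * (ρ s₀ - ρ₀) - (ρ s₀ * u s₀ - ρ₀ * 0) = 0
  /-- Rankine-Hugoniot condition `s₀ [u] - [u² / 2 + h(ρ)] = 0`. -/
  rh_bernoulli : s₀ * (u s₀ - 0) -
    ((u s₀ ^ 2 / 2 + enthalpy A γ (ρ s₀)) - (0 ^ 2 / 2 + enthalpy A γ ρ₀)) = 0
  /-- Lax entropy conditions on the shock. -/
  lax_left : u s₀ - soundSpeed A γ (ρ s₀) < s₀
  lax_right : s₀ < u s₀ + soundSpeed A γ (ρ s₀)
  lax_ahead : soundSpeed A γ ρ₀ < s₀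
  /-- Solid wall condition on the piston. -/
  piston : u b₀ = b₀

/-- `x = m (1 + O(b₀ ^ (-2 / (γ - 1))) + O(b₀ ^ (-2)))`, with `C` as the constant in the `O`s. -/
def ApproxRel (C γ b₀ x m : ℝ) : Prop :=
  ∃ θ : ℝ, |θ| ≤ C * (b₀ ^ (-(2 / (γ - 1))) + b₀ ^ (-2 : ℝ)) ∧ x = m * (1 + θ)

end PistonFlow

end

/-!
Between piston and shock `u` decreases from `u(b₀) = b₀` and the Bernoulli identity
`(c²)' = (γ - 1) (s - u) u'` holds, so `c²` is decreasing while `c² + (γ - 1) / 2 * (s - u)²` is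
increasing. Together with the Bernoulli condition on the shock this traps `c²` within `c(ρ₀)²` of
`(γ - 1) / 2 * s₀²`. The adiabatic law turns the lower bound into
`ρ₀ / ρ(s₀) = O(b₀ ^ (-2 / (γ - 1)))`, and by conservation of mass the lag `s₀ - u(s₀)` of the gas
behind the shock is `s₀` times this ratio. Since `u(s₀) ≤ u(s) ≤ b₀ ≤ s ≤ s₀`, the lag controls all
velocities, and the remaining estimates are algebra of relative errors.
-/

namespace PistonFlow

open Filter Asymptotics Topology

/-! ### Flow between piston and shock -/

theorem ne_zero_of_hasDerivWithinAt_mul_self {a b : ℝ} {f g : ℝ → ℝ}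
    (hg : ContinuousOn g (Icc a b))
    (hf : ∀ x ∈ Icc a b, HasDerivWithinAt f (g x * f x) (Icc a b) x) (hfa : f a ≠ 0) :
    ∀ x ∈ Icc a b, f x ≠ 0 := by
  intro x hx hfx
  obtain ⟨M, hM⟩ := isCompact_Icc.exists_bound_of_continuousOn hg
  have hsub : Icc a x ⊆ Icc a b := Icc_subset_Icc_right hx.2
  have hlip : ∀ t ∈ Ioc a x, LipschitzOnWith M.toNNReal (g t * ·) univ := fun t ht =>
    (LipschitzWith.of_dist_le_mul fun y z => by
      rw [Real.dist_eq, Real.dist_eq, ← mul_sub, abs_mul]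
      gcongr
      exact (hM t (hsub (Ioc_subset_Icc_self ht))).trans M.le_coe_toNNReal).lipschitzOnWith
  have hderiv : ∀ t ∈ Ioc a x, HasDerivWithinAt f (g t * f t) (Iic t) t := fun t ht =>
    (hf t (hsub (Ioc_subset_Icc_self ht))).mono_of_mem_nhdsWithin
      (Icc_mem_nhdsLE_of_mem ⟨ht.1, ht.2.trans hx.2⟩)
  have hzero : EqOn f (fun _ => 0) (Icc a x) :=
    ODE_solution_unique_of_mem_Icc_left hlip
      (fun t ht => (hf t (hsub ht)).continuousWithinAt.mono hsub) hderiv (fun _ _ => mem_univ _)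
      continuousOn_const
      (fun t _ => by simpa only [mul_zero] using hasDerivWithinAt_const t (Iic t) (0 : ℝ))
      (fun _ _ => mem_univ _) hfx
  exact hfa (hzero (left_mem_Icc.mpr hx.1))

theorem pos_of_continuousOn_of_ne_zero {f : ℝ → ℝ} {S : Set ℝ} (hS : IsPreconnected S)
    (hf : ContinuousOn f S) (h0 : ∀ x ∈ S, f x ≠ 0) {y : ℝ} (hy : y ∈ S) (hfy : 0 < f y) :
    ∀ x ∈ S, 0 < f x := by
  intro x hx
  by_contra! hneg
  obtain ⟨z, hz, hfz⟩ := hS.intermediate_value hx hy hf ⟨hneg, hfy.le⟩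
  exact h0 z hz hfz

theorem soundSpeed_sq {A γ ρ : ℝ} (hA : 0 ≤ A) (hγ : 0 ≤ γ) (hρ : 0 < ρ) :
    soundSpeed A γ ρ ^ 2 = A * γ * ρ ^ (γ - 1) := by
  rw [soundSpeed_of_pos hρ, Real.sq_sqrt (by positivity)]

theorem soundSpeed_nonneg (A γ ρ : ℝ) : 0 ≤ soundSpeed A γ ρ := Real.sqrt_nonneg _

namespace IsBackgroundSolution

variable {n : ℕ} {A γ ρ₀ b₀ s₀ s : ℝ} {ρ u : ℝ → ℝ}

theorem left_mem (h : IsBackgroundSolution n A γ ρ₀ b₀ s₀ ρ u) : b₀ ∈ Icc b₀ s₀ :=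
  left_mem_Icc.mpr h.shock_ahead.le

theorem right_mem (h : IsBackgroundSolution n A γ ρ₀ b₀ s₀ ρ u) : s₀ ∈ Icc b₀ s₀ :=
  right_mem_Icc.mpr h.shock_ahead.le

theorem continuousOn_density (h : IsBackgroundSolution n A γ ρ₀ b₀ s₀ ρ u) :
    ContinuousOn ρ (Icc b₀ s₀) := fun s hs => (h.density_ode s hs).continuousWithinAt

theorem continuousOn_velocity (h : IsBackgroundSolution n A γ ρ₀ b₀ s₀ ρ u) :
    ContinuousOn u (Icc b₀ s₀) := fun s hs => (h.velocity_ode s hs).continuousWithinAt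

theorem continuousOn_soundSpeed (h : IsBackgroundSolution n A γ ρ₀ b₀ s₀ ρ u) :
    ContinuousOn (fun s => soundSpeed A γ (ρ s)) (Icc b₀ s₀) :=
  (continuousOn_const.mul (h.continuousOn_density.rpow_const
    fun s hs => Or.inl (h.density_pos s hs).ne')).sqrt.congr
    fun s hs => soundSpeed_of_pos (h.density_pos s hs)

theorem continuousOn_denom (h : IsBackgroundSolution n A γ ρ₀ b₀ s₀ ρ u) :
    ContinuousOn (fun s => denom A γ s (ρ s) (u s)) (Icc b₀ s₀) :=
  ((continuousOn_id.sub h.continuousOn_velocity).pow 2).sub (h.continuousOn_soundSpeed.pow 2)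

theorem denom_neg (h : IsBackgroundSolution n A γ ρ₀ b₀ s₀ ρ u) (hs : s ∈ Icc b₀ s₀) :
    denom A γ s (ρ s) (u s) < 0 := by
  have hshock : denom A γ s₀ (ρ s₀) (u s₀) < 0 :=
    sub_neg.mpr (sq_lt_sq' (by linarith [h.lax_left]) (by linarith [h.lax_right]))
  exact neg_pos.mp (pos_of_continuousOn_of_ne_zero isPreconnected_Icc h.continuousOn_denom.neg
    (fun x hx => neg_ne_zero.mpr (h.denom_ne_zero x hx)) h.right_mem (neg_pos.mpr hshock) s hs)

theorem soundSpeed_sq_pos (h : IsBackgroundSolution n A γ ρ₀ b₀ s₀ ρ u) (hs : s ∈ Icc b₀ s₀) :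
    0 < soundSpeed A γ (ρ s) ^ 2 :=
  (sq_nonneg _).trans_lt (sub_neg.mp (h.denom_neg hs))

theorem velocity_pos (h : IsBackgroundSolution n A γ ρ₀ b₀ s₀ ρ u) (hb : 0 < b₀)
    (hs : s ∈ Icc b₀ s₀) : 0 < u s := by
  have hcoeff : ContinuousOn (fun s => ((n : ℝ) - 1) * soundSpeed A γ (ρ s) ^ 2 /
      (s * denom A γ s (ρ s) (u s))) (Icc b₀ s₀) :=
    (continuousOn_const.mul (h.continuousOn_soundSpeed.pow 2)).div
      (continuousOn_id.mul h.continuousOn_denom)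
      fun s hs => mul_ne_zero (hb.trans_le hs.1).ne' (h.denom_ne_zero s hs)
  have hu_ne : ∀ s ∈ Icc b₀ s₀, u s ≠ 0 :=
    ne_zero_of_hasDerivWithinAt_mul_self hcoeff
      (fun s hs => (h.velocity_ode s hs).congr_deriv (by ring)) (h.piston.trans_ne hb.ne')
  exact pos_of_continuousOn_of_ne_zero isPreconnected_Icc h.continuousOn_velocity hu_ne
    h.left_mem (hb.trans_eq h.piston.symm) s hs

theorem derivWithin_velocity (h : IsBackgroundSolution n A γ ρ₀ b₀ s₀ ρ u)
    (hs : s ∈ Icc b₀ s₀) : derivWithin u (Icc b₀ s₀) s =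
      ((n : ℝ) - 1) * soundSpeed A γ (ρ s) ^ 2 * u s / (s * denom A γ s (ρ s) (u s)) :=
  (h.velocity_ode s hs).derivWithin (uniqueDiffOn_Icc h.shock_ahead s hs)

theorem hasDerivWithinAt_velocity (h : IsBackgroundSolution n A γ ρ₀ b₀ s₀ ρ u)
    (hs : s ∈ Icc b₀ s₀) :
    HasDerivWithinAt u (derivWithin u (Icc b₀ s₀) s) (Icc b₀ s₀) s :=
  (h.velocity_ode s hs).differentiableWithinAt.hasDerivWithinAt

theorem derivWithin_density (h : IsBackgroundSolution n A γ ρ₀ b₀ s₀ ρ u) (hs : s ∈ Icc b₀ s₀) :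
    derivWithin ρ (Icc b₀ s₀) s =
      ρ s * (s - u s) / soundSpeed A γ (ρ s) ^ 2 * derivWithin u (Icc b₀ s₀) s := by
  rw [(h.density_ode s hs).derivWithin (uniqueDiffOn_Icc h.shock_ahead s hs),
    h.derivWithin_velocity hs]
  have hc : soundSpeed A γ (ρ s) ≠ 0 :=
    (pow_ne_zero_iff two_ne_zero).mp (h.soundSpeed_sq_pos hs).ne'
  field_simp

theorem derivWithin_velocity_nonpos (h : IsBackgroundSolution n A γ ρ₀ b₀ s₀ ρ u) (hn : 1 ≤ n)
    (hb : 0 < b₀) (hs : s ∈ Icc b₀ s₀) : derivWithin u (Icc b₀ s₀) s ≤ 0 := by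
  have hu := h.velocity_pos hb hs
  have hn' : (0 : ℝ) ≤ n - 1 := sub_nonneg.mpr (by exact_mod_cast hn)
  rw [h.derivWithin_velocity hs]
  exact div_nonpos_of_nonneg_of_nonpos (by positivity)
    (mul_nonpos_of_nonneg_of_nonpos (hb.le.trans hs.1) (h.denom_neg hs).le)

theorem velocity_antitone (h : IsBackgroundSolution n A γ ρ₀ b₀ s₀ ρ u) (hn : 1 ≤ n)
    (hb : 0 < b₀) : AntitoneOn u (Icc b₀ s₀) :=
  antitoneOn_of_hasDerivWithinAt_nonpos (convex_Icc b₀ s₀) h.continuousOn_velocity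
    (fun _ hx => (h.hasDerivWithinAt_velocity (interior_subset hx)).mono interior_subset)
    (fun _ hx => h.derivWithin_velocity_nonpos hn hb (interior_subset hx))

theorem velocity_mem_Icc (h : IsBackgroundSolution n A γ ρ₀ b₀ s₀ ρ u) (hn : 1 ≤ n)
    (hb : 0 < b₀) (hs : s ∈ Icc b₀ s₀) : u s ∈ Icc (u s₀) b₀ :=
  ⟨h.velocity_antitone hn hb hs h.right_mem hs.2,
    (h.velocity_antitone hn hb h.left_mem hs hs.1).trans_eq h.piston⟩

theorem velocity_le (h : IsBackgroundSolution n A γ ρ₀ b₀ s₀ ρ u) (hn : 1 ≤ n)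
    (hb : 0 < b₀) (hs : s ∈ Icc b₀ s₀) : u s ≤ s :=
  (h.velocity_mem_Icc hn hb hs).2.trans hs.1

theorem hasDerivWithinAt_soundSpeed_sq (h : IsBackgroundSolution n A γ ρ₀ b₀ s₀ ρ u)
    (hA : 0 ≤ A) (hγ : 0 ≤ γ) (hs : s ∈ Icc b₀ s₀) :
    HasDerivWithinAt (fun s => soundSpeed A γ (ρ s) ^ 2)
      ((γ - 1) * (s - u s) * derivWithin u (Icc b₀ s₀) s) (Icc b₀ s₀) s := by
  have hρ := h.density_pos s hs
  have hAγ : A * γ ≠ 0 :=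
    left_ne_zero_of_mul (soundSpeed_sq hA hγ hρ ▸ (h.soundSpeed_sq_pos hs).ne')
  have hρ' := (h.density_ode s hs).differentiableWithinAt.hasDerivWithinAt
  refine (((hρ'.rpow_const (p := γ - 1) (Or.inl hρ.ne')).const_mul (A * γ)).congr
    (fun x hx => soundSpeed_sq hA hγ (h.density_pos x hx))
    (soundSpeed_sq hA hγ hρ)).congr_deriv ?_
  rw [h.derivWithin_density hs, soundSpeed_sq hA hγ hρ, Real.rpow_sub_one hρ.ne' (γ - 1)]
  generalize A * γ = κ at hAγ ⊢
  field_simp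

theorem soundSpeed_sq_antitone (h : IsBackgroundSolution n A γ ρ₀ b₀ s₀ ρ u) (hn : 1 ≤ n)
    (hA : 0 ≤ A) (hγ : 1 ≤ γ) (hb : 0 < b₀) :
    AntitoneOn (fun s => soundSpeed A γ (ρ s) ^ 2) (Icc b₀ s₀) :=
  antitoneOn_of_hasDerivWithinAt_nonpos (convex_Icc b₀ s₀) (h.continuousOn_soundSpeed.pow 2)
    (fun _ hx => (h.hasDerivWithinAt_soundSpeed_sq hA (by linarith)
      (interior_subset hx)).mono interior_subset)
    (fun _ hx => mul_nonpos_of_nonneg_of_nonpos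
      (mul_nonneg (by linarith) (sub_nonneg.mpr (h.velocity_le hn hb (interior_subset hx))))
      (h.derivWithin_velocity_nonpos hn hb (interior_subset hx)))

theorem soundSpeed_sq_add_lag_sq_monotone (h : IsBackgroundSolution n A γ ρ₀ b₀ s₀ ρ u)
    (hn : 1 ≤ n) (hA : 0 ≤ A) (hγ : 1 ≤ γ) (hb : 0 < b₀) :
    MonotoneOn (fun s => soundSpeed A γ (ρ s) ^ 2 + (γ - 1) / 2 * (s - u s) ^ 2)
      (Icc b₀ s₀) := by
  have hderiv : ∀ x ∈ Icc b₀ s₀, HasDerivWithinAt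
      (fun s => soundSpeed A γ (ρ s) ^ 2 + (γ - 1) / 2 * (s - u s) ^ 2)
      ((γ - 1) * (x - u x)) (Icc b₀ s₀) x := by
    intro x hx
    have hlag : HasDerivWithinAt (fun s => s - u s) (1 - derivWithin u (Icc b₀ s₀) x)
        (Icc b₀ s₀) x := (hasDerivWithinAt_id x _).sub (h.hasDerivWithinAt_velocity hx)
    exact ((h.hasDerivWithinAt_soundSpeed_sq hA (by linarith) hx).add
      ((hlag.pow 2).const_mul ((γ - 1) / 2))).congr_deriv (by push_cast; ring)
  exact monotoneOn_of_hasDerivWithinAt_nonneg (convex_Icc b₀ s₀)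
    (fun x hx => (hderiv x hx).continuousWithinAt)
    (fun x hx => (hderiv x (interior_subset hx)).mono interior_subset)
    (fun x hx => mul_nonneg (by linarith)
      (sub_nonneg.mpr (h.velocity_le hn hb (interior_subset hx))))

theorem shock_lag_eq (h : IsBackgroundSolution n A γ ρ₀ b₀ s₀ ρ u) :
    s₀ - u s₀ = s₀ * (ρ₀ / ρ s₀) := by
  have hρ := h.density_pos s₀ h.right_mem
  field_simp
  linarith [h.rh_mass]

theorem density_ratio_lt_one (h : IsBackgroundSolution n A γ ρ₀ b₀ s₀ ρ u) (hb : 0 < b₀) :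
    ρ₀ / ρ s₀ < 1 := by
  have hu : s₀ * (ρ₀ / ρ s₀) < s₀ * 1 := by
    linarith [h.shock_lag_eq, h.velocity_pos hb h.right_mem]
  exact lt_of_mul_lt_mul_left hu (hb.trans h.shock_ahead).le

theorem soundSpeed_sq_shock_eq (h : IsBackgroundSolution n A γ ρ₀ b₀ s₀ ρ u) (hγ : γ ≠ 1) :
    soundSpeed A γ (ρ s₀) ^ 2 + (γ - 1) / 2 * (s₀ - u s₀) ^ 2 =
      soundSpeed A γ ρ₀ ^ 2 + (γ - 1) / 2 * s₀ ^ 2 := by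
  have hγ' : γ - 1 ≠ 0 := sub_ne_zero.mpr hγ
  have hRH := h.rh_bernoulli
  simp only [enthalpy] at hRH
  field_simp at hRH
  linarith

theorem density_ratio_rpow_mul (h : IsBackgroundSolution n A γ ρ₀ b₀ s₀ ρ u) (hA : 0 ≤ A)
    (hγ : 0 ≤ γ) (hρ₀ : 0 < ρ₀) :
    (ρ₀ / ρ s₀) ^ (γ - 1) * soundSpeed A γ (ρ s₀) ^ 2 = soundSpeed A γ ρ₀ ^ 2 := by
  have hρ := h.density_pos s₀ h.right_mem
  rw [soundSpeed_sq hA hγ hρ, soundSpeed_sq hA hγ hρ₀, Real.div_rpow hρ₀.le hρ.le]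
  field_simp

/-- With `q = ρ₀ / ρ(s₀) < 1` and `γ - 1 ≤ 2` the adiabatic law gives `q² c² ≤ c(ρ₀)²` behind the
shock; the Bernoulli relation turns this into a bound with a common factor `1 - q²`. -/
theorem shock_lag_sq_le (h : IsBackgroundSolution n A γ ρ₀ b₀ s₀ ρ u) (hA : 0 ≤ A)
    (hγ₁ : 1 < γ) (hγ₃ : γ ≤ 3) (hρ₀ : 0 < ρ₀) (hb : 0 < b₀) :
    (γ - 1) / 2 * (s₀ - u s₀) ^ 2 ≤ soundSpeed A γ ρ₀ ^ 2 := by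
  have hρ := h.density_pos s₀ h.right_mem
  have hbern := h.soundSpeed_sq_shock_eq hγ₁.ne'
  have hq1 := h.density_ratio_lt_one hb
  have hpow := h.density_ratio_rpow_mul hA (by linarith) hρ₀
  rw [h.shock_lag_eq] at hbern ⊢
  have hq0 : 0 < ρ₀ / ρ s₀ := by positivity
  set q := ρ₀ / ρ s₀
  have hqpow : q ^ 2 ≤ q ^ (γ - 1) := by
    rw [← Real.rpow_two]
    exact Real.rpow_le_rpow_of_exponent_ge hq0 hq1.le (by linarith)
  have hqc : q ^ 2 * soundSpeed A γ (ρ s₀) ^ 2 ≤ soundSpeed A γ ρ₀ ^ 2 :=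
    (mul_le_mul_of_nonneg_right hqpow (sq_nonneg _)).trans_eq hpow
  have hfactor : 0 < 1 - q ^ 2 := by nlinarith
  refine le_of_mul_le_mul_right ?_ hfactor
  rw [show soundSpeed A γ (ρ s₀) ^ 2 = soundSpeed A γ ρ₀ ^ 2 + (γ - 1) / 2 * s₀ ^ 2 -
    (γ - 1) / 2 * (s₀ * q) ^ 2 by linarith] at hqc
  linarith

theorem soundSpeed_sq_mem_Icc (h : IsBackgroundSolution n A γ ρ₀ b₀ s₀ ρ u) (hn : 1 ≤ n)
    (hA : 0 ≤ A) (hγ₁ : 1 < γ) (hγ₃ : γ ≤ 3) (hρ₀ : 0 < ρ₀) (hb : 0 < b₀) (hs : s ∈ Icc b₀ s₀) :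
    soundSpeed A γ (ρ s) ^ 2 ∈
      Icc ((γ - 1) / 2 * s₀ ^ 2) (soundSpeed A γ ρ₀ ^ 2 + (γ - 1) / 2 * s₀ ^ 2) := by
  have hbern := h.soundSpeed_sq_shock_eq hγ₁.ne'
  have hlower := h.soundSpeed_sq_antitone hn hA hγ₁.le hb hs h.right_mem hs.2
  have hupper := h.soundSpeed_sq_add_lag_sq_monotone hn hA hγ₁.le hb hs h.right_mem hs.2
  have hlag : 0 ≤ (γ - 1) / 2 * (s - u s) ^ 2 :=
    mul_nonneg (by linarith) (sq_nonneg _)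
  constructor <;> linarith [h.shock_lag_sq_le hA hγ₁ hγ₃ hρ₀ hb]

theorem density_ratio_le (h : IsBackgroundSolution n A γ ρ₀ b₀ s₀ ρ u) (hn : 1 ≤ n)
    (hA : 0 ≤ A) (hγ₁ : 1 < γ) (hγ₃ : γ ≤ 3) (hρ₀ : 0 < ρ₀) (hb : 0 < b₀) :
    ρ₀ / ρ s₀ ≤
      (2 * soundSpeed A γ ρ₀ ^ 2 / (γ - 1)) ^ (1 / (γ - 1)) * s₀ ^ (-(2 / (γ - 1))) := by
  have hk : 0 < γ - 1 := by linarith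
  have hs₀ : 0 < s₀ := hb.trans h.shock_ahead
  have hq : 0 < ρ₀ / ρ s₀ := div_pos hρ₀ (h.density_pos s₀ h.right_mem)
  have hpow : (ρ₀ / ρ s₀) ^ (γ - 1) ≤
      2 * soundSpeed A γ ρ₀ ^ 2 / (γ - 1) * s₀ ^ (-2 : ℝ) := by
    rw [← h.density_ratio_rpow_mul hA (by linarith) hρ₀, Real.rpow_neg hs₀.le, Real.rpow_two,
      ← div_eq_mul_inv, le_div_iff₀ (by positivity), le_div_iff₀ hk]
    have hc := (h.soundSpeed_sq_mem_Icc hn hA hγ₁ hγ₃ hρ₀ hb h.right_mem).1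
    have := mul_le_mul_of_nonneg_left hc (by positivity : 0 ≤ (ρ₀ / ρ s₀) ^ (γ - 1))
    linarith
  calc ρ₀ / ρ s₀ = ((ρ₀ / ρ s₀) ^ (γ - 1)) ^ (1 / (γ - 1)) := by
        rw [one_div, Real.rpow_rpow_inv hq.le hk.ne']
    _ ≤ (2 * soundSpeed A γ ρ₀ ^ 2 / (γ - 1) * s₀ ^ (-2 : ℝ)) ^ (1 / (γ - 1)) := by gcongr
    _ = _ := by
        rw [Real.mul_rpow (by positivity) (by positivity), ← Real.rpow_mul hs₀.le]
        ring_nf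

end IsBackgroundSolution

/-! ### Relative errors -/

/-- `x = m (1 + O(ε))` along `l`, written as a bound on the difference. -/
def RelApprox {ι : Type*} (l : Filter ι) (ε x m : ι → ℝ) : Prop :=
  (fun i => x i - m i) =O[l] fun i => ε i * m i

namespace RelApprox

variable {ι : Type*} {l : Filter ι} {ε x y m m' : ι → ℝ}

theorem refl (l : Filter ι) (ε m : ι → ℝ) : RelApprox l ε m m := by
  simpa only [RelApprox, sub_self] using isBigO_zero _ _

theorem congr' (h : RelApprox l ε x m) (hx : x =ᶠ[l] y) (hm : m =ᶠ[l] m') :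
    RelApprox l ε y m' :=
  IsBigO.congr' h (hx.sub hm) (EventuallyEq.rfl.mul hm)

theorem isEquivalent (h : RelApprox l ε x m) (hε : Tendsto ε l (𝓝 0)) : x ~[l] m :=
  h.trans_isLittleO <| by
    simpa only [one_mul] using ((isLittleO_one_iff ℝ).mpr hε).mul_isBigO (isBigO_refl m l)

theorem neg (h : RelApprox l ε x m) : RelApprox l ε (fun i => -x i) (fun i => -m i) :=
  (IsBigO.neg_left h).neg_right.congr (fun _ => by ring) (fun _ => by ring)

theorem add_isBigO (h : RelApprox l ε x m) (hy : y =O[l] fun i => ε i * m i) :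
    RelApprox l ε (fun i => x i + y i) m :=
  (IsBigO.add h hy).congr_left fun _ => by ring

theorem add_const_mul {a a' : ℝ} (hx : RelApprox l ε x fun i => a * m i)
    (hy : RelApprox l ε y fun i => a' * m i) (ha : a + a' ≠ 0) :
    RelApprox l ε (fun i => x i + y i) fun i => (a + a') * m i := by
  have hto : ∀ b : ℝ, (fun i => ε i * (b * m i)) =O[l] fun i => ε i * ((a + a') * m i) :=
    fun b => ((isBigO_refl (fun i => ε i * m i) l).const_mul_left b).const_mul_right ha
      |>.congr (fun _ => by ring) (fun _ => by ring)
  exact ((IsBigO.trans hx (hto a)).add (IsBigO.trans hy (hto a'))).congr_left fun _ => by ring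

theorem mul (hx : RelApprox l ε x m) (hy : RelApprox l ε y m') (hε : Tendsto ε l (𝓝 0)) :
    RelApprox l ε (fun i => x i * y i) (fun i => m i * m' i) := by
  have hfirst : (fun i => (x i - m i) * y i) =O[l] fun i => ε i * (m i * m' i) :=
    (IsBigO.mul hx (hy.isEquivalent hε).isBigO).congr_right fun _ => by ring
  have hsecond : (fun i => m i * (y i - m' i)) =O[l] fun i => ε i * (m i * m' i) :=
    ((isBigO_refl m l).mul hy).congr_right fun _ => by ring
  exact (hfirst.add hsecond).congr_left fun _ => by ring

theorem const_mul (h : RelApprox l ε x m) (a : ℝ) :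
    RelApprox l ε (fun i => a * x i) (fun i => a * m i) :=
  ((isBigO_refl (fun _ => a) l).mul h).congr (fun _ => by ring) (fun _ => by ring)

theorem comp_div_mul {φ : ℝ → ℝ} (hφ : DifferentiableAt ℝ φ 1) (hφ₁ : φ 1 = 1)
    (h : RelApprox l ε x m) (hε : Tendsto ε l (𝓝 0)) (hm : ∀ᶠ i in l, m i ≠ 0) :
    RelApprox l ε (fun i => φ (x i / m i) * m' i) m' := by
  have hratio : Tendsto (fun i => x i / m i) l (𝓝 1) :=
    (isEquivalent_iff_tendsto_one hm).mp (h.isEquivalent hε)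
  have hratio_sub : (fun i => x i / m i - 1) =O[l] ε :=
    (IsBigO.mul h (isBigO_refl (fun i => (m i)⁻¹) l)).congr'
      (hm.mono fun i hi => by field_simp) (hm.mono fun i hi => by field_simp)
  exact (((hφ.isBigO_sub.comp_tendsto hratio).trans hratio_sub).mul (isBigO_refl m' l)).congr_left
    fun i => by simp only [Function.comp_apply, hφ₁]; ring

theorem inv (h : RelApprox l ε x m) (hε : Tendsto ε l (𝓝 0)) (hm : ∀ᶠ i in l, m i ≠ 0) :
    RelApprox l ε (fun i => (x i)⁻¹) (fun i => (m i)⁻¹) :=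
  (h.comp_div_mul (differentiableAt_inv one_ne_zero) inv_one hε hm).congr'
    (hm.mono fun i hi => by field_simp) .rfl

theorem rpow (h : RelApprox l ε x m) (hε : Tendsto ε l (𝓝 0)) (hm : ∀ᶠ i in l, 0 < m i)
    (p : ℝ) : RelApprox l ε (fun i => x i ^ p) (fun i => m i ^ p) := by
  have hx := (h.isEquivalent hε).eventually_pos hm
  refine (h.comp_div_mul (Real.differentiableAt_rpow_const_of_ne p one_ne_zero) (Real.one_rpow p)
    hε (hm.mono fun _ hi => hi.ne')).congr' ?_ .rfl
  filter_upwards [hx, hm] with i hxi hmi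
  rw [← Real.mul_rpow (by positivity) hmi.le, div_mul_cancel₀ _ hmi.ne']

end RelApprox

/-- The size `b ^ (-2 / (γ - 1)) + b ^ (-2)` of the relative errors `θ` for piston speed `b`. -/
noncomputable def errorScale (γ b : ℝ) : ℝ := b ^ (-(2 / (γ - 1))) + b ^ (-2 : ℝ)

theorem tendsto_errorScale {γ : ℝ} (hγ : 1 < γ) : Tendsto (errorScale γ) atTop (𝓝 0) := by
  have hη := tendsto_rpow_neg_atTop (div_pos two_pos (sub_pos.mpr hγ))
  exact add_zero (0 : ℝ) ▸ hη.add (tendsto_rpow_neg_atTop two_pos)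

theorem RelApprox.eventually_approxRel {ι : Type*} {l : Filter ι} {γ : ℝ} {b x m : ι → ℝ}
    (h : RelApprox l (fun i => errorScale γ (b i)) x m) (hb : ∀ᶠ i in l, 0 ≤ b i)
    (hm : ∀ᶠ i in l, m i ≠ 0) :
    ∀ᶠ C in atTop, ∀ᶠ i in l, ApproxRel C γ (b i) (x i) (m i) := by
  filter_upwards [isBigO_iff_eventually.mp h] with C hC
  filter_upwards [hC, hb, hm] with i hi hbi hmi
  have hE : 0 ≤ errorScale γ (b i) := by unfold errorScale; positivity
  refine ⟨(x i - m i) / m i, ?_, by field_simp; ring⟩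
  rw [norm_mul, Real.norm_eq_abs, Real.norm_eq_abs, Real.norm_eq_abs, abs_of_nonneg hE,
    ← mul_assoc] at hi
  rwa [abs_div, div_le_iff₀ (abs_pos.mpr hmi)]

theorem RelApprox.eventually_approxRel_and_pos {ι : Type*} {l : Filter ι} {γ : ℝ}
    {b x m : ι → ℝ} (h : RelApprox l (fun i => errorScale γ (b i)) x m)
    (hγ : 1 < γ) (hb : Tendsto b l atTop) (hm : ∀ᶠ i in l, 0 < m i) :
    ∀ᶠ C in atTop, ∀ᶠ i in l, ApproxRel C γ (b i) (x i) (m i) ∧ 0 < x i := by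
  filter_upwards [h.eventually_approxRel (hb.eventually_ge_atTop 0) (hm.mono fun _ hi => hi.ne')]
    with C hC
  exact hC.and ((h.isEquivalent ((tendsto_errorScale hγ).comp hb)).eventually_pos hm)

theorem RelApprox.eventually_approxRel_and_neg {ι : Type*} {l : Filter ι} {γ : ℝ}
    {b x m : ι → ℝ} (h : RelApprox l (fun i => errorScale γ (b i)) x m)
    (hγ : 1 < γ) (hb : Tendsto b l atTop) (hm : ∀ᶠ i in l, m i < 0) :
    ∀ᶠ C in atTop, ∀ᶠ i in l, ApproxRel C γ (b i) (x i) (m i) ∧ x i < 0 := by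
  filter_upwards [h.eventually_approxRel (hb.eventually_ge_atTop 0) (hm.mono fun _ hi => hi.ne)]
    with C hC
  exact hC.and ((h.isEquivalent ((tendsto_errorScale hγ).comp hb)).eventually_neg hm)

/-! ### Fast pistons -/

/-- A background solution in some dimension `2 ≤ n ≤ N`, together with a point `s` between its
piston and its shock. Estimates uniform in the solution and the point are asymptotic statements
on this type. -/
structure SolutionPoint (N : ℕ) (A γ ρ₀ : ℝ) where
  n : ℕ
  b₀ : ℝ
  s₀ : ℝ
  ρ : ℝ → ℝ
  u : ℝ → ℝ
  s : ℝ
  two_le : 2 ≤ n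
  le : n ≤ N
  isBackgroundSolution : IsBackgroundSolution n A γ ρ₀ b₀ s₀ ρ u
  mem : s ∈ Icc b₀ s₀

/-- The limit `b₀ → ∞`, uniform in everything else. -/
def largePiston (N : ℕ) (A γ ρ₀ : ℝ) : Filter (SolutionPoint N A γ ρ₀) :=
  comap SolutionPoint.b₀ atTop

namespace SolutionPoint

variable {N : ℕ} {A γ ρ₀ : ℝ}

/-- The sound speed at the given point. -/
noncomputable def c (p : SolutionPoint N A γ ρ₀) : ℝ := soundSpeed A γ (p.ρ p.s)

/-- The relative error allowed for `p`. -/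
noncomputable def err (p : SolutionPoint N A γ ρ₀) : ℝ := errorScale γ p.b₀

theorem one_le (p : SolutionPoint N A γ ρ₀) : 1 ≤ p.n := one_le_two.trans p.two_le

theorem tendsto_piston : Tendsto SolutionPoint.b₀ (largePiston N A γ ρ₀) atTop := tendsto_comap

theorem eventually_piston_pos : ∀ᶠ p in largePiston N A γ ρ₀, 0 < p.b₀ :=
  tendsto_piston.eventually_gt_atTop 0

theorem tendsto_err (hγ : 1 < γ) : Tendsto err (largePiston N A γ ρ₀) (𝓝 0) :=
  (tendsto_errorScale hγ).comp tendsto_piston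

theorem piston_rpow_isBigO_err :
    (fun p => p.b₀ ^ (-(2 / (γ - 1)))) =O[largePiston N A γ ρ₀] err := by
  refine .of_norm_eventuallyLE ?_
  filter_upwards [eventually_piston_pos] with p hb
  rw [Real.norm_of_nonneg (by positivity)]
  exact le_add_of_nonneg_right (by positivity)

theorem one_isBigO :
    (fun _ => (1 : ℝ)) =O[largePiston N A γ ρ₀] fun p => p.err * p.b₀ ^ 2 := by
  refine .of_norm_eventuallyLE ?_
  filter_upwards [eventually_piston_pos] with p hb
  calc ‖(1 : ℝ)‖ = p.b₀ ^ (-2 : ℝ) * p.b₀ ^ 2 := by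
        rw [norm_one, Real.rpow_neg hb.le, Real.rpow_two, inv_mul_cancel₀ (by positivity)]
    _ ≤ p.err * p.b₀ ^ 2 := by
        gcongr
        exact le_add_of_nonneg_left (by positivity)

theorem density_ratio_isBigO (hA : 0 < A) (hγ₁ : 1 < γ) (hγ₃ : γ ≤ 3) (hρ₀ : 0 < ρ₀) :
    (fun p => ρ₀ / p.ρ p.s₀) =O[largePiston N A γ ρ₀] fun p => p.b₀ ^ (-(2 / (γ - 1))) := by
  have hk : 0 < γ - 1 := sub_pos.mpr hγ₁
  refine .of_bound ((2 * soundSpeed A γ ρ₀ ^ 2 / (γ - 1)) ^ (1 / (γ - 1))) ?_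
  filter_upwards [eventually_piston_pos] with p hb
  have h := p.isBackgroundSolution
  have hq : 0 < ρ₀ / p.ρ p.s₀ := div_pos hρ₀ (h.density_pos _ h.right_mem)
  rw [Real.norm_of_nonneg hq.le, Real.norm_of_nonneg (by positivity)]
  refine (h.density_ratio_le p.one_le hA.le hγ₁ hγ₃ hρ₀ hb).trans ?_
  gcongr ?_ * ?_
  exact Real.rpow_le_rpow_of_nonpos hb h.shock_ahead.le (neg_nonpos.mpr (div_pos two_pos hk).le)

theorem shock_isBigO (hA : 0 < A) (hγ₁ : 1 < γ) (hγ₃ : γ ≤ 3) (hρ₀ : 0 < ρ₀) :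
    SolutionPoint.s₀ =O[largePiston N A γ ρ₀] SolutionPoint.b₀ := by
  have hη : Tendsto (fun p => p.b₀ ^ (-(2 / (γ - 1)))) (largePiston N A γ ρ₀) (𝓝 0) :=
    (tendsto_rpow_neg_atTop (div_pos two_pos (sub_pos.mpr hγ₁))).comp tendsto_piston
  have hq : Tendsto (fun p => ρ₀ / p.ρ p.s₀) (largePiston N A γ ρ₀) (𝓝 0) :=
    (density_ratio_isBigO hA hγ₁ hγ₃ hρ₀).trans_tendsto hη
  refine .of_bound 2 ?_
  filter_upwards [eventually_piston_pos, hq.eventually_le_const one_half_pos] with p hb hqp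
  have h := p.isBackgroundSolution
  have hs₀ : 0 < p.s₀ := hb.trans h.shock_ahead
  rw [Real.norm_of_nonneg hs₀.le, Real.norm_of_nonneg hb.le]
  linarith [h.shock_lag_eq, mul_le_mul_of_nonneg_left hqp hs₀.le,
    (h.velocity_mem_Icc p.one_le hb h.right_mem).2]

theorem shock_lag_isBigO (hA : 0 < A) (hγ₁ : 1 < γ) (hγ₃ : γ ≤ 3) (hρ₀ : 0 < ρ₀) :
    (fun p => p.s₀ - p.u p.s₀) =O[largePiston N A γ ρ₀]
      fun p => p.b₀ ^ (-(2 / (γ - 1))) * p.b₀ :=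
  ((density_ratio_isBigO hA hγ₁ hγ₃ hρ₀).mul (shock_isBigO hA hγ₁ hγ₃ hρ₀)).congr_left
    fun p => (mul_comm _ _).trans p.isBackgroundSolution.shock_lag_eq.symm

theorem lag_isBigO_rpow (hA : 0 < A) (hγ₁ : 1 < γ) (hγ₃ : γ ≤ 3) (hρ₀ : 0 < ρ₀) :
    (fun p => p.s - p.u p.s) =O[largePiston N A γ ρ₀]
      fun p => p.b₀ ^ (-(2 / (γ - 1))) * p.b₀ := by
  refine .trans (.of_norm_eventuallyLE ?_) (shock_lag_isBigO hA hγ₁ hγ₃ hρ₀)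
  filter_upwards [eventually_piston_pos] with p hb
  have hu := p.isBackgroundSolution.velocity_mem_Icc p.one_le hb p.mem
  have hu_le := p.isBackgroundSolution.velocity_le p.one_le hb p.mem
  rw [Real.norm_of_nonneg (sub_nonneg.mpr hu_le)]
  exact sub_le_sub p.mem.2 hu.1

theorem lag_isBigO (hA : 0 < A) (hγ₁ : 1 < γ) (hγ₃ : γ ≤ 3) (hρ₀ : 0 < ρ₀) :
    (fun p => p.s - p.u p.s) =O[largePiston N A γ ρ₀] fun p => p.err * p.b₀ :=
  (lag_isBigO_rpow hA hγ₁ hγ₃ hρ₀).trans (piston_rpow_isBigO_err.mul (isBigO_refl _ _))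

theorem relApprox_piston_of_mem_Icc (hA : 0 < A) (hγ₁ : 1 < γ) (hγ₃ : γ ≤ 3)
    (hρ₀ : 0 < ρ₀) {f : SolutionPoint N A γ ρ₀ → ℝ}
    (hf : ∀ᶠ p in largePiston N A γ ρ₀, f p ∈ Icc (p.u p.s₀) p.s₀) :
    RelApprox (largePiston N A γ ρ₀) err f SolutionPoint.b₀ := by
  refine .trans (.of_norm_eventuallyLE ?_) ((shock_lag_isBigO hA hγ₁ hγ₃ hρ₀).trans
    (piston_rpow_isBigO_err.mul (isBigO_refl _ _)))
  filter_upwards [hf, eventually_piston_pos] with p hfp hb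
  have h := p.isBackgroundSolution
  exact abs_sub_le_of_le_of_le hfp.1 hfp.2 (h.velocity_mem_Icc p.one_le hb h.right_mem).2
    h.shock_ahead.le

theorem shock_relApprox (hA : 0 < A) (hγ₁ : 1 < γ) (hγ₃ : γ ≤ 3) (hρ₀ : 0 < ρ₀) :
    RelApprox (largePiston N A γ ρ₀) err SolutionPoint.s₀ SolutionPoint.b₀ := by
  refine relApprox_piston_of_mem_Icc hA hγ₁ hγ₃ hρ₀ ?_
  filter_upwards [eventually_piston_pos] with p hb
  have h := p.isBackgroundSolution
  exact ⟨h.velocity_le p.one_le hb h.right_mem, le_rfl⟩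

theorem point_relApprox (hA : 0 < A) (hγ₁ : 1 < γ) (hγ₃ : γ ≤ 3) (hρ₀ : 0 < ρ₀) :
    RelApprox (largePiston N A γ ρ₀) err SolutionPoint.s SolutionPoint.b₀ := by
  refine relApprox_piston_of_mem_Icc hA hγ₁ hγ₃ hρ₀ ?_
  filter_upwards [eventually_piston_pos] with p hb
  have h := p.isBackgroundSolution
  exact ⟨(h.velocity_mem_Icc p.one_le hb h.right_mem).2.trans p.mem.1, p.mem.2⟩

theorem velocity_relApprox (hA : 0 < A) (hγ₁ : 1 < γ) (hγ₃ : γ ≤ 3) (hρ₀ : 0 < ρ₀) :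
    RelApprox (largePiston N A γ ρ₀) err (fun p => p.u p.s) SolutionPoint.b₀ := by
  refine relApprox_piston_of_mem_Icc hA hγ₁ hγ₃ hρ₀ ?_
  filter_upwards [eventually_piston_pos] with p hb
  have hu := p.isBackgroundSolution.velocity_mem_Icc p.one_le hb p.mem
  exact ⟨hu.1, hu.2.trans p.isBackgroundSolution.shock_ahead.le⟩

theorem soundSpeed_sq_relApprox (hA : 0 < A) (hγ₁ : 1 < γ) (hγ₃ : γ ≤ 3) (hρ₀ : 0 < ρ₀) :
    RelApprox (largePiston N A γ ρ₀) err (fun p => p.c ^ 2) fun p => (γ - 1) / 2 * p.b₀ ^ 2 := by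
  have hk : (γ - 1) / 2 ≠ 0 := (half_pos (sub_pos.mpr hγ₁)).ne'
  have hshock : RelApprox (largePiston N A γ ρ₀) err (fun p => p.s₀ ^ 2) fun p => p.b₀ ^ 2 := by
    simpa only [sq] using (shock_relApprox hA hγ₁ hγ₃ hρ₀).mul
      (shock_relApprox hA hγ₁ hγ₃ hρ₀) (tendsto_err hγ₁)
  have hbounded : (fun p => p.c ^ 2 - (γ - 1) / 2 * p.s₀ ^ 2) =O[largePiston N A γ ρ₀]
      fun _ => (1 : ℝ) := by
    refine .of_bound (soundSpeed A γ ρ₀ ^ 2) ?_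
    filter_upwards [eventually_piston_pos] with p hb
    have hc : p.c ^ 2 ∈ Icc ((γ - 1) / 2 * p.s₀ ^ 2)
        (soundSpeed A γ ρ₀ ^ 2 + (γ - 1) / 2 * p.s₀ ^ 2) :=
      p.isBackgroundSolution.soundSpeed_sq_mem_Icc p.one_le hA.le hγ₁ hγ₃ hρ₀ hb p.mem
    rw [norm_one, mul_one, Real.norm_of_nonneg (sub_nonneg.mpr hc.1)]
    exact sub_le_iff_le_add.mpr hc.2
  have herr : (fun p => p.err * p.b₀ ^ 2) =O[largePiston N A γ ρ₀]
      fun p => p.err * ((γ - 1) / 2 * p.b₀ ^ 2) :=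
    ((isBigO_refl _ _).const_mul_right hk).congr_right fun _ => mul_left_comm _ _ _
  exact ((hshock.const_mul _).add_isBigO (hbounded.trans (one_isBigO.trans herr))).congr'
    (.of_forall fun _ => add_sub_cancel _ _) .rfl

theorem soundSpeed_relApprox (hA : 0 < A) (hγ₁ : 1 < γ) (hγ₃ : γ ≤ 3) (hρ₀ : 0 < ρ₀) :
    RelApprox (largePiston N A γ ρ₀) err c fun p => √((γ - 1) / 2) * p.b₀ := by
  have hk : 0 < (γ - 1) / 2 := half_pos (sub_pos.mpr hγ₁)
  refine ((soundSpeed_sq_relApprox hA hγ₁ hγ₃ hρ₀).rpow (tendsto_err hγ₁)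
    (eventually_piston_pos.mono fun p hb => by positivity) (1 / 2)).congr' ?_ ?_
  · filter_upwards with p
    rw [← Real.sqrt_eq_rpow]
    exact Real.sqrt_sq (soundSpeed_nonneg A γ (p.ρ p.s))
  · filter_upwards [eventually_piston_pos] with p hb
    rw [← Real.sqrt_eq_rpow, Real.sqrt_mul hk.le, Real.sqrt_sq hb.le]

theorem density_relApprox (hA : 0 < A) (hγ₁ : 1 < γ) (hγ₃ : γ ≤ 3) (hρ₀ : 0 < ρ₀) :
    RelApprox (largePiston N A γ ρ₀) err (fun p => p.ρ p.s)
      fun p => ((γ - 1) / (2 * A * γ)) ^ (1 / (γ - 1)) * p.b₀ ^ (2 / (γ - 1)) := by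
  have hk : 0 < γ - 1 := sub_pos.mpr hγ₁
  have hγ : 0 < γ := one_pos.trans hγ₁
  refine (((soundSpeed_sq_relApprox hA hγ₁ hγ₃ hρ₀).const_mul (A * γ)⁻¹).rpow (tendsto_err hγ₁)
    (eventually_piston_pos.mono fun p hb => by positivity) (1 / (γ - 1))).congr' ?_ ?_
  · filter_upwards with p
    have hρ := p.isBackgroundSolution.density_pos p.s p.mem
    rw [c, soundSpeed_sq hA.le hγ.le hρ, inv_mul_cancel_left₀ (by positivity), one_div,
      Real.rpow_rpow_inv hρ.le hk.ne']
  · filter_upwards [eventually_piston_pos] with p hb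
    rw [show (A * γ)⁻¹ * ((γ - 1) / 2 * p.b₀ ^ 2) = (γ - 1) / (2 * A * γ) * p.b₀ ^ 2 by
      field_simp, Real.mul_rpow (by positivity) (by positivity), ← Real.rpow_natCast_mul hb.le]
    norm_num [div_eq_mul_inv]

theorem denom_relApprox (hA : 0 < A) (hγ₁ : 1 < γ) (hγ₃ : γ ≤ 3) (hρ₀ : 0 < ρ₀) :
    RelApprox (largePiston N A γ ρ₀) err (fun p => (p.s - p.u p.s) ^ 2 - p.c ^ 2)
      fun p => -((γ - 1) / 2 * p.b₀ ^ 2) := by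
  have hk : -((γ - 1) / 2) ≠ 0 := (neg_neg_of_pos (half_pos (sub_pos.mpr hγ₁))).ne
  have hlag : (fun p => (p.s - p.u p.s) ^ 2) =O[largePiston N A γ ρ₀]
      fun p => p.err * -((γ - 1) / 2 * p.b₀ ^ 2) := by
    have hone : err =O[largePiston N A γ ρ₀] fun _ => (1 : ℝ) := (tendsto_err hγ₁).isBigO_one ℝ
    have hsq := (lag_isBigO hA hγ₁ hγ₃ hρ₀).mul (lag_isBigO (N := N) hA hγ₁ hγ₃ hρ₀)
    refine (hsq.trans ?_).congr_left fun p => (sq _).symm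
    refine ((hone.mul (isBigO_refl (fun p => p.err * p.b₀ ^ 2) _)).const_mul_right hk).congr
      (fun p => by ring) (fun p => by ring)
  exact ((soundSpeed_sq_relApprox hA hγ₁ hγ₃ hρ₀).neg.add_isBigO hlag).congr'
    (.of_forall fun p => by ring) .rfl

theorem lag_isBigO_soundSpeed_scale (hA : 0 < A) (hγ₁ : 1 < γ) (hγ₃ : γ ≤ 3) (hρ₀ : 0 < ρ₀) :
    (fun p => p.s - p.u p.s) =O[largePiston N A γ ρ₀]
      fun p => p.err * (√((γ - 1) / 2) * p.b₀) :=
  ((lag_isBigO hA hγ₁ hγ₃ hρ₀).const_mul_right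
    (Real.sqrt_pos.mpr (half_pos (sub_pos.mpr hγ₁))).ne').congr_right
      fun _ => mul_left_comm _ _ _

theorem forward_characteristic_relApprox (hA : 0 < A) (hγ₁ : 1 < γ) (hγ₃ : γ ≤ 3) (hρ₀ : 0 < ρ₀) :
    RelApprox (largePiston N A γ ρ₀) err (fun p => p.u p.s + p.c - p.s)
      fun p => √((γ - 1) / 2) * p.b₀ :=
  ((soundSpeed_relApprox hA hγ₁ hγ₃ hρ₀).add_isBigO
    (lag_isBigO_soundSpeed_scale hA hγ₁ hγ₃ hρ₀).neg_left).congr'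
      (.of_forall fun p => by ring) .rfl

theorem backward_characteristic_relApprox (hA : 0 < A) (hγ₁ : 1 < γ) (hγ₃ : γ ≤ 3) (hρ₀ : 0 < ρ₀) :
    RelApprox (largePiston N A γ ρ₀) err (fun p => p.u p.s - p.c - p.s)
      fun p => -(√((γ - 1) / 2) * p.b₀) :=
  ((soundSpeed_relApprox hA hγ₁ hγ₃ hρ₀).add_isBigO
    (lag_isBigO_soundSpeed_scale hA hγ₁ hγ₃ hρ₀)).neg.congr'
      (.of_forall fun p => by ring) .rfl

theorem derivWithin_velocity_relApprox (hA : 0 < A) (hγ₁ : 1 < γ) (hγ₃ : γ ≤ 3) (hρ₀ : 0 < ρ₀) :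
    RelApprox (largePiston N A γ ρ₀) err (fun p => derivWithin p.u (Icc p.b₀ p.s₀) p.s)
      fun p => -((p.n : ℝ) - 1) := by
  have hε : Tendsto err (largePiston N A γ ρ₀) (𝓝 0) := tendsto_err hγ₁
  have hk : 0 < γ - 1 := sub_pos.mpr hγ₁
  have hnum := ((RelApprox.refl (largePiston N A γ ρ₀) err fun p => (p.n : ℝ) - 1).mul
    (soundSpeed_sq_relApprox hA hγ₁ hγ₃ hρ₀) hε).mul (velocity_relApprox hA hγ₁ hγ₃ hρ₀) hε
  have hden := (point_relApprox hA hγ₁ hγ₃ hρ₀).mul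
    (denom_relApprox (N := N) hA hγ₁ hγ₃ hρ₀) hε
  have hden_ne : ∀ᶠ p in largePiston N A γ ρ₀, p.b₀ * -((γ - 1) / 2 * p.b₀ ^ 2) ≠ 0 :=
    eventually_piston_pos.mono fun p hb => by simp [hb.ne', hk.ne']
  refine (hnum.mul (hden.inv hε hden_ne) hε).congr' ?_ ?_
  · filter_upwards with p
    rw [p.isBackgroundSolution.derivWithin_velocity p.mem]
    exact (div_eq_mul_inv _ _).symm
  · filter_upwards [eventually_piston_pos] with p hb
    field_simp

theorem velocity_sq_sub_soundSpeed_sq_relApprox (hA : 0 < A) (hγ₁ : 1 < γ) (hγ₃ : γ < 3)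
    (hρ₀ : 0 < ρ₀) :
    RelApprox (largePiston N A γ ρ₀) err (fun p => p.u p.s ^ 2 - p.c ^ 2)
      fun p => (3 - γ) / 2 * p.b₀ ^ 2 := by
  have hu := velocity_relApprox (N := N) hA hγ₁ hγ₃.le hρ₀
  have husq : RelApprox (largePiston N A γ ρ₀) err (fun p => p.u p.s ^ 2)
      fun p => 1 * p.b₀ ^ 2 := by
    simpa only [sq, one_mul] using hu.mul hu (tendsto_err hγ₁)
  have hcsq : RelApprox (largePiston N A γ ρ₀) err (fun p => -p.c ^ 2)
      fun p => -((γ - 1) / 2) * p.b₀ ^ 2 := by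
    simpa only [neg_mul] using (soundSpeed_sq_relApprox hA hγ₁ hγ₃.le hρ₀).neg
  have hne : 1 + -((γ - 1) / 2) ≠ 0 := ne_of_gt (by linarith)
  exact (husq.add_const_mul hcsq hne).congr' (.of_forall fun p => by ring)
    (.of_forall fun p => by ring)

theorem derivWithin_density_isBigO (hA : 0 < A) (hγ₁ : 1 < γ) (hγ₃ : γ ≤ 3) (hρ₀ : 0 < ρ₀) :
    (fun p => derivWithin p.ρ (Icc p.b₀ p.s₀) p.s) =O[largePiston N A γ ρ₀]
      fun p => p.b₀⁻¹ := by
  have hε : Tendsto err (largePiston N A γ ρ₀) (𝓝 0) := tendsto_err hγ₁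
  have hρ : (fun p => p.ρ p.s) =O[largePiston N A γ ρ₀] fun p => p.b₀ ^ (2 / (γ - 1)) :=
    ((density_relApprox hA hγ₁ hγ₃ hρ₀).isEquivalent hε).isBigO.trans
      (isBigO_const_mul_self _ _ _)
  have hc : (fun p => (p.c ^ 2)⁻¹) =O[largePiston N A γ ρ₀] fun p => (p.b₀ ^ 2)⁻¹ := by
    have hcsq := ((soundSpeed_sq_relApprox (N := N) hA hγ₁ hγ₃ hρ₀).isEquivalent hε).inv.isBigO
    refine hcsq.trans ((isBigO_const_mul_self ((γ - 1) / 2)⁻¹ _ _).congr_left fun p => ?_)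
    exact (mul_inv _ _).symm
  have hu' : (fun p => derivWithin p.u (Icc p.b₀ p.s₀) p.s) =O[largePiston N A γ ρ₀]
      fun _ => (1 : ℝ) := by
    refine ((derivWithin_velocity_relApprox hA hγ₁ hγ₃ hρ₀).isEquivalent hε).isBigO.trans
      (.of_bound N (.of_forall fun p => ?_))
    have h₁ : (1 : ℝ) ≤ p.n := by exact_mod_cast p.one_le
    have hN : (p.n : ℝ) ≤ N := by exact_mod_cast p.le
    rw [norm_neg, norm_one, mul_one, Real.norm_of_nonneg (sub_nonneg.mpr h₁)]
    linarith
  -- For `γ < 2` the term `b₀ ^ (-2)` dominates `err`, so `lag_isBigO` would be too weak here: only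
  -- the power `b₀ ^ (-2 / (γ - 1))` cancels the growth of `ρ`.
  refine (((hρ.mul (lag_isBigO_rpow hA hγ₁ hγ₃ hρ₀)).mul hc).mul hu').congr' ?_ ?_
  · filter_upwards with p
    rw [p.isBackgroundSolution.derivWithin_density p.mem, div_eq_mul_inv]
    rfl
  · filter_upwards [eventually_piston_pos] with p hb
    rw [← mul_assoc, ← Real.rpow_add hb, add_neg_cancel, Real.rpow_zero]
    field_simp

end SolutionPoint

/-- Estimates (ii)–(ix) of the lemma at one point `s`, with the constant `C`. -/
def FlowEstimates (C : ℝ) (n : ℕ) (A γ b₀ s₀ : ℝ) (ρ u : ℝ → ℝ) (s : ℝ) : Prop :=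
  ApproxRel C γ b₀ (u s) b₀ ∧
  ApproxRel C γ b₀ (ρ s) (((γ - 1) / (2 * A * γ)) ^ (1 / (γ - 1)) * b₀ ^ (2 / (γ - 1))) ∧
  (ApproxRel C γ b₀ (u s ^ 2 - soundSpeed A γ (ρ s) ^ 2) ((3 - γ) / 2 * b₀ ^ 2) ∧
    0 < u s ^ 2 - soundSpeed A γ (ρ s) ^ 2) ∧
  (ApproxRel C γ b₀ ((s - u s) ^ 2 - soundSpeed A γ (ρ s) ^ 2) (-((γ - 1) / 2 * b₀ ^ 2)) ∧
    (s - u s) ^ 2 - soundSpeed A γ (ρ s) ^ 2 < 0) ∧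
  (ApproxRel C γ b₀ (u s + soundSpeed A γ (ρ s) - s) (√((γ - 1) / 2) * b₀) ∧
    0 < u s + soundSpeed A γ (ρ s) - s) ∧
  (ApproxRel C γ b₀ (u s - soundSpeed A γ (ρ s) - s) (-(√((γ - 1) / 2) * b₀)) ∧
    u s - soundSpeed A γ (ρ s) - s < 0) ∧
  |derivWithin ρ (Icc b₀ s₀) s| ≤ C * b₀⁻¹ ∧
  (ApproxRel C γ b₀ (derivWithin u (Icc b₀ s₀) s) (-((n : ℝ) - 1)) ∧
    derivWithin u (Icc b₀ s₀) s < 0)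

open SolutionPoint in
theorem eventually_flowEstimates {N : ℕ} {A γ ρ₀ : ℝ} (hA : 0 < A) (hγ₁ : 1 < γ) (hγ₃ : γ < 3)
    (hρ₀ : 0 < ρ₀) :
    ∀ᶠ C in atTop, ∀ᶠ p in largePiston N A γ ρ₀,
      FlowEstimates C p.n A γ p.b₀ p.s₀ p.ρ p.u p.s := by
  have hk : 0 < (γ - 1) / 2 := half_pos (sub_pos.mpr hγ₁)
  have hb : ∀ᶠ p in largePiston N A γ ρ₀, 0 < p.b₀ := eventually_piston_pos
  have hb₀ : Tendsto SolutionPoint.b₀ (largePiston N A γ ρ₀) atTop := tendsto_piston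
  have hb_sq : ∀ {a : ℝ}, 0 < a → ∀ᶠ p in largePiston N A γ ρ₀, 0 < a * p.b₀ ^ 2 := fun ha =>
    hb.mono fun _ h => mul_pos ha (pow_pos h 2)
  have hsound : ∀ᶠ p in largePiston N A γ ρ₀, 0 < √((γ - 1) / 2) * p.b₀ :=
    hb.mono fun _ h => mul_pos (Real.sqrt_pos.mpr hk) h
  have hii := (velocity_relApprox (N := N) hA hγ₁ hγ₃.le hρ₀).eventually_approxRel
    (hb.mono fun _ h => h.le) (hb.mono fun _ h => h.ne')
  have hiii := (density_relApprox (N := N) hA hγ₁ hγ₃.le hρ₀).eventually_approxRel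
    (hb.mono fun _ h => h.le) (hb.mono fun _ h => by positivity)
  have hiv := (velocity_sq_sub_soundSpeed_sq_relApprox (N := N) hA hγ₁ hγ₃
    hρ₀).eventually_approxRel_and_pos hγ₁ hb₀ (hb_sq (half_pos (sub_pos.mpr hγ₃)))
  have hv := (denom_relApprox (N := N) hA hγ₁ hγ₃.le hρ₀).eventually_approxRel_and_neg
    hγ₁ hb₀ ((hb_sq hk).mono fun _ => neg_neg_of_pos)
  have hvi := (forward_characteristic_relApprox (N := N) hA hγ₁ hγ₃.le
    hρ₀).eventually_approxRel_and_pos hγ₁ hb₀ hsound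
  have hvii := (backward_characteristic_relApprox (N := N) hA hγ₁ hγ₃.le
    hρ₀).eventually_approxRel_and_neg hγ₁ hb₀ (hsound.mono fun _ => neg_neg_of_pos)
  have hviii := isBigO_iff_eventually.mp (derivWithin_density_isBigO (N := N) hA hγ₁ hγ₃.le hρ₀)
  have hix := (derivWithin_velocity_relApprox (N := N) hA hγ₁ hγ₃.le
    hρ₀).eventually_approxRel_and_neg hγ₁ hb₀ (.of_forall fun p =>
      neg_neg_of_pos (sub_pos.mpr (by exact_mod_cast p.two_le)))
  filter_upwards [hii, hiii, hiv, hv, hvi, hvii, hviii, hix]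
    with C hC₂ hC₃ hC₄ hC₅ hC₆ hC₇ hC₈ hC₉
  filter_upwards [hb, hC₂, hC₃, hC₄, hC₅, hC₆, hC₇, hC₈, hC₉] with p hp h₂ h₃ h₄ h₅ h₆ h₇ h₈ h₉
  rw [Real.norm_eq_abs, Real.norm_of_nonneg (inv_nonneg.mpr hp.le)] at h₈
  exact ⟨h₂, h₃, h₄, h₅, h₆, h₇, h₈, h₉⟩

theorem lemma2p1_general (N : ℕ) (γ A ρ₀ : ℝ) (hγ₁ : 1 < γ) (hγ₃ : γ < 3) (hA : 0 < A)
    (hρ₀ : 0 < ρ₀) :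
    ∃ B C : ℝ, 0 < B ∧ 0 < C ∧
      ∀ n : ℕ, 2 ≤ n → n ≤ N →
      ∀ b₀ : ℝ, B ≤ b₀ →
      ∀ (s₀ : ℝ) (ρ u : ℝ → ℝ), IsBackgroundSolution n A γ ρ₀ b₀ s₀ ρ u →
        ApproxRel C γ b₀ s₀ b₀ ∧
        ∀ s ∈ Icc b₀ s₀, FlowEstimates C n A γ b₀ s₀ ρ u s := by
  have hb : ∀ᶠ p in largePiston N A γ ρ₀, 0 < p.b₀ := SolutionPoint.eventually_piston_pos
  have hshock := (SolutionPoint.shock_relApprox (N := N) hA hγ₁ hγ₃.le hρ₀).eventually_approxRel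
    (hb.mono fun _ h => h.le) (hb.mono fun _ h => h.ne')
  obtain ⟨C, ⟨hC_shock, hC_flow⟩, hC⟩ := ((hshock.and
    (eventually_flowEstimates (N := N) hA hγ₁ hγ₃ hρ₀)).and (eventually_gt_atTop 0)).exists
  obtain ⟨B, hB⟩ := eventually_atTop.mp (eventually_comap.mp (hC_shock.and hC_flow))
  refine ⟨max B 1, C, by positivity, hC, fun n hn₂ hnN b₀ hb₀ s₀ ρ u h => ?_⟩
  have hpoint : ∀ s ∈ Icc b₀ s₀,
      ApproxRel C γ b₀ s₀ b₀ ∧ FlowEstimates C n A γ b₀ s₀ ρ u s := fun s hs =>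
    hB b₀ ((le_max_left B 1).trans hb₀) ⟨n, b₀, s₀, ρ, u, s, hn₂, hnN, h, hs⟩ rfl
  exact ⟨(hpoint b₀ h.left_mem).1, fun s hs => (hpoint s hs).2⟩

end PistonFlow

open PistonFlow in
theorem lemma2p1 (γ A ρ₀ : ℝ) (hγ₁ : 1 < γ) (hγ₃ : γ < 3) (hA : 0 < A) (hρ₀ : 0 < ρ₀) :
    ∃ B C : ℝ, 0 < B ∧ 0 < C ∧
      ∀ n : ℕ, n = 2 ∨ n = 3 →
      ∀ b₀ : ℝ, B ≤ b₀ →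
      ∀ (s₀ : ℝ) (ρ u : ℝ → ℝ), IsBackgroundSolution n A γ ρ₀ b₀ s₀ ρ u →
        ApproxRel C γ b₀ s₀ b₀ ∧
        ∀ s ∈ Set.Icc b₀ s₀,
          ApproxRel C γ b₀ (u s) b₀ ∧
          ApproxRel C γ b₀ (ρ s)
            (((γ - 1) / (2 * A * γ)) ^ (1 / (γ - 1)) * b₀ ^ (2 / (γ - 1))) ∧
          (ApproxRel C γ b₀ (u s ^ 2 - soundSpeed A γ (ρ s) ^ 2) ((3 - γ) / 2 * b₀ ^ 2) ∧
            0 < u s ^ 2 - soundSpeed A γ (ρ s) ^ 2) ∧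
          (ApproxRel C γ b₀ ((s - u s) ^ 2 - soundSpeed A γ (ρ s) ^ 2)
              (-((γ - 1) / 2 * b₀ ^ 2)) ∧
            (s - u s) ^ 2 - soundSpeed A γ (ρ s) ^ 2 < 0) ∧
          (ApproxRel C γ b₀ (u s + soundSpeed A γ (ρ s) - s) (√((γ - 1) / 2) * b₀) ∧
            0 < u s + soundSpeed A γ (ρ s) - s) ∧
          (ApproxRel C γ b₀ (u s - soundSpeed A γ (ρ s) - s) (-(√((γ - 1) / 2) * b₀)) ∧
            u s - soundSpeed A γ (ρ s) - s < 0) ∧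
          |derivWithin ρ (Set.Icc b₀ s₀) s| ≤ C * b₀⁻¹ ∧
          (ApproxRel C γ b₀ (derivWithin u (Set.Icc b₀ s₀) s) (-((n : ℝ) - 1)) ∧
            derivWithin u (Set.Icc b₀ s₀) s < 0) := by
  obtain ⟨B, C, hB, hC, hflow⟩ := lemma2p1_general 3 γ A ρ₀ hγ₁ hγ₃ hA hρ₀
  exact ⟨B, C, hB, hC, fun n hn => hflow n (by omega) (by omega)⟩
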